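/- For integers $p\ge 1$, $n\ge 1$ let $H_n^{(p)}=\sum_{k=1}^n k^{-p}$, and for positive integers $\pi_1,\dots,\pi_m$ and an integer $q\ge2$ let $$S_{\pi_1\cdots\pi_m,q}=\sum_{n=1}^\infty \frac{H_n^{(\pi_1)}\cdots H_n^{(\pi_m)}}{n^q},$$ where repeated indices are written as powers (so $S_{r^2,q}$ has numerator $(H_n^{(r)})^2$). The sums $S_{p,q}$ with $m=1$ are called linear. A polynomial in zeta values is an element of the $\mathbb{Q}$-algebra $\mathcal{Z}\subset\mathbb{R}$ generated by the numbers $\zeta(s)=\sum_{n\ge1}n^{-s}$, $s=2,3,4,\dots$. Then for every integer $r\ge 2$: 1. $S_{r^2,r}=\tfrac13\zeta(r)^3-\tfrac13\zeta(3r)+S_{r,2r}$. 2. $S_{r^3,r}=\tfrac14\zeta(r)^4+\tfrac34\zeta(2r)^2+\zeta(4r)-S_{r,3r}+\tfrac32S_{r^2,2r}-\tfrac32S_{2r,2r}$. 3. Both $S_{r^2,r}$ and $S_{r^3,r}$ are reducible to linear sums and polynomials in zeta values: each is a finite sum $P_0+\sum_i P_i\,S_{p_i,q_i}$ with $P_0,P_i\in\mathcal{Z}$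 and integers $p_i\ge1$, $q_i\ge2$. 4. If $r\geq 3$ is odd, then $S_{r^2,r}\in\mathcal{Z}$, i.e. $S_{r^2,r}$ is a polynomial with rational coefficients in zeta values. -/

import Mathlib

noncomputable section

namespace EulerSums

/-- The generalized harmonic number `H_n^{(r)} = ∑_{k=1}^n 1 / k^r`. -/
def genHarmonic (r n : ℕ) : ℝ := ∑ k ∈ Finset.Icc 1 n, 1 / (k : ℝ) ^ r

/-- The Euler sum `S_{π,q} = ∑_{n ≥ 1} (∏_{p ∈ π} H_n^{(p)}) / n^q`, where the partition `π` is given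
as the multiset of its parts. It converges for `q ≥ 2` and positive parts, see
`summable_eulerSum`. -/
def eulerSum (π : Multiset ℕ) (q : ℕ) : ℝ :=
  ∑' n : ℕ, (π.map (fun p => genHarmonic p (n + 1))).prod / ((n : ℝ) + 1) ^ q

/-- The zeta value `ζ(s) = ∑_{n ≥ 1} 1 / n^s` as a real number (used for integers `s ≥ 2`). -/
def zetaValue (s : ℕ) : ℝ := ∑' n : ℕ, 1 / ((n : ℝ) + 1) ^ s

/-- The polynomials in zeta values: the `ℚ`-subalgebra of `ℝ` generated by the numbers `ζ(s)`,
`s ≥ 2`. -/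
def zetaAlgebra : Subalgebra ℚ ℝ := Algebra.adjoin ℚ {x : ℝ | ∃ s : ℕ, 2 ≤ s ∧ x = zetaValue s}

/-- The real numbers that are reducible to linear Euler sums and polynomials in zeta values:
the finite sums `P₀ + ∑ Pᵢ * S_{pᵢ,qᵢ}` with `pᵢ ≥ 1`, `qᵢ ≥ 2`, where `P₀` and the `Pᵢ` are
polynomials with rational coefficients in zeta values. -/
def linearReducible : Submodule zetaAlgebra ℝ :=
  Submodule.span zetaAlgebra
    ({1} ∪ {x : ℝ | ∃ p q : ℕ, 1 ≤ p ∧ 2 ≤ q ∧ x = eulerSum {p} q})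

/-- For `s ≥ 2` the real zeta value is the value of the Riemann zeta function. -/
theorem zetaValue_eq_riemannZeta (s : ℕ) (hs : 2 ≤ s) : (zetaValue s : ℂ) = riemannZeta s := by
  rw [zeta_eq_tsum_one_div_nat_add_one_cpow (by simp; omega)]
  unfold zetaValue
  push_cast
  refine tsum_congr fun n => ?_
  rw [Complex.cpow_natCast]

theorem genHarmonic_nonneg (p n : ℕ) : 0 ≤ genHarmonic p n :=
  Finset.sum_nonneg fun _ _ => by positivity

theorem genHarmonic_le (p n : ℕ) (hp : 1 ≤ p) : genHarmonic p n ≤ 1 + Real.log n := by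
  refine le_trans ?_ (harmonic_le_one_add_log n)
  rw [harmonic_eq_sum_Icc]
  push_cast
  refine Finset.sum_le_sum fun k hk => ?_
  have h1 : (1 : ℝ) ≤ k := by exact_mod_cast (Finset.mem_Icc.mp hk).1
  rw [one_div]
  exact inv_anti₀ (by linarith) (le_self_pow₀ h1 (by omega))

theorem prod_genHarmonic_bounds (π : Multiset ℕ) (hπ : ∀ p ∈ π, 1 ≤ p) (n : ℕ) :
    0 ≤ (π.map (fun p => genHarmonic p n)).prod ∧
      (π.map (fun p => genHarmonic p n)).prod ≤ (1 + Real.log n) ^ π.card := by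
  induction π using Multiset.induction_on with
  | empty => simp
  | cons a t ih =>
    obtain ⟨h0, h1⟩ := ih fun p hp => hπ p (Multiset.mem_cons_of_mem hp)
    have h2 := genHarmonic_nonneg a n
    have h3 := genHarmonic_le a n (hπ a (Multiset.mem_cons_self a t))
    simp only [Multiset.map_cons, Multiset.prod_cons, Multiset.card_cons]
    refine ⟨mul_nonneg h2 h0, ?_⟩
    rw [pow_succ']
    exact mul_le_mul h3 h1 h0 (h2.trans h3)

/-- The series defining an Euler sum converges for `q ≥ 2`. -/
theorem summable_eulerSum (π : Multiset ℕ) (hπ : ∀ p ∈ π, 1 ≤ p) (q : ℕ) (hq : 2 ≤ q) :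
    Summable fun n : ℕ =>
      (π.map (fun p => genHarmonic p (n + 1))).prod / ((n : ℝ) + 1) ^ q := by
  have hlog : (fun x : ℝ => (1 + Real.log x) ^ π.card) =O[Filter.atTop]
      fun x : ℝ => x ^ (1 / 2 : ℝ) := by
    have h1 : (fun x : ℝ => 1 + Real.log x) =O[Filter.atTop] Real.log :=
      (Real.isLittleO_const_log_atTop.isBigO).add (Asymptotics.isBigO_refl _ _)
    refine (h1.pow π.card).trans ?_
    have h2 := (isLittleO_log_rpow_rpow_atTop (s := 1 / 2) (π.card : ℝ) (by norm_num)).isBigO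
    simpa using h2
  have hn : (fun n : ℕ => (π.map (fun p => genHarmonic p n)).prod / (n : ℝ) ^ q)
      =O[Filter.atTop] fun n : ℕ => (n : ℝ) ^ (-(3 / 2) : ℝ) := by
    have hA : (fun n : ℕ => (π.map (fun p => genHarmonic p n)).prod)
        =O[Filter.atTop] fun n : ℕ => (n : ℝ) ^ (1 / 2 : ℝ) := by
      refine Asymptotics.IsBigO.trans ?_ (hlog.comp_tendsto tendsto_natCast_atTop_atTop)
      refine Asymptotics.IsBigO.of_bound 1 (Filter.Eventually.of_forall fun n => ?_)
      obtain ⟨h0, h1⟩ := prod_genHarmonic_bounds π hπ n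
      rw [Real.norm_of_nonneg h0, one_mul]
      exact h1.trans (le_abs_self _)
    have hB : (fun n : ℕ => ((n : ℝ) ^ q)⁻¹)
        =O[Filter.atTop] fun n : ℕ => (n : ℝ) ^ (-2 : ℝ) := by
      refine Asymptotics.IsBigO.of_bound 1 ?_
      filter_upwards [Filter.eventually_ge_atTop 1] with n hn
      have h1 : (1 : ℝ) ≤ n := by exact_mod_cast hn
      rw [Real.norm_of_nonneg (by positivity), Real.norm_of_nonneg (by positivity), one_mul,
        Real.rpow_neg (by positivity), Real.rpow_two]
      exact inv_anti₀ (by positivity) (pow_le_pow_right₀ h1 hq)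
    refine (hA.mul hB).congr' (Filter.Eventually.of_forall fun n => (div_eq_mul_inv _ _).symm) ?_
    filter_upwards [Filter.eventually_ge_atTop 1] with n hn
    have h1 : (0 : ℝ) < n := by exact_mod_cast hn
    rw [← Real.rpow_add h1]
    norm_num
  have hs := summable_of_isBigO_nat (Real.summable_nat_rpow.mpr (by norm_num)) hn
  have := (summable_nat_add_iff 1).mpr hs
  simpa using this

end EulerSums

end

/-! Formulas 1 and 2 come from telescoping: with H = H_n^(r) and x = n^(-r), the differences H^m -
(H - x)^m sum to ζ(r)^m, and expanding them for m = 3, 4 gives Euler sums (`eulerSum_sq_self`,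
`eulerSum_cube_self`). The case m = 2 with 2r for r removes S_{2r,2r}. What remains is to reduce
S_{r^2,2r} to linear sums and, for odd r, S_{r,2r} to zeta values.

Both follow by evaluating an absolutely convergent sum over n ∈ ℤ in two orders, with 1/0 = 0. In ∑
n^(-2r) (n-k)^(-r) (n-l)^(-r) over k, l ≥ 1, summing over k and l first gives squares of ±ζ(r) + H
or ±(ζ(r) - H), hence 2 S_{r^2,2r} plus linear terms (`tsum_triple_eq`). Summing over n first,
partial fractions reduce everything to symmetric sums of n^(-i) over ℤ, which are 0 for odd i and
2ζ(i) for even i. Their coefficients, and the corrections at the omitted points n = 0, k, l, are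
products of powers of two of k, l, k - l, and such double series are linear sums or zeta polynomials
(`tsum_triple_mem`).

The analogous sum ∑ n^(-c) (n-k)^(-a) has coefficients in k alone, so it is a zeta polynomial
(`tsum_double_mem`). Summed over k first it contains S_{a,c} with factor 1 - (-1)^(a+c), which is 2
in odd weight. -/

open Filter Topology

namespace EulerSums

/-! ### Principal parts and partial fractions. -/

/-- The Taylor expansion of `(u + X)⁻ᵇ` at `X = 0`. -/
noncomputable def invPowSeries (b : ℕ) (u : ℝ) : PowerSeries ℝ :=
  PowerSeries.mk fun i => (-1) ^ i * ((b + i - 1).choose i : ℝ) * (u ^ (b + i))⁻¹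

/-- Truncated subtraction gives the right values at b = 0: the binomial is 1 for i = 0 and (i-1
choose i) = 0 for i ≥ 1. -/
theorem invPowSeries_zero (u : ℝ) : invPowSeries 0 u = 1 := by
  ext i
  rcases i with _ | i
  · simp [invPowSeries]
  · simp [invPowSeries, PowerSeries.coeff_one]

/-- On coefficients this is Pascal's rule. It drives the inductions behind the partial fractions. -/
theorem add_X_mul_invPowSeries (b : ℕ) {u : ℝ} (hu : u ≠ 0) :
    (PowerSeries.C u + PowerSeries.X) * invPowSeries (b + 1) u = invPowSeries b u := by
  ext i
  rw [add_mul, map_add, PowerSeries.coeff_C_mul]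
  rcases i with _ | i
  · simp [invPowSeries]
    field_simp
    ring
  · rw [PowerSeries.coeff_succ_X_mul]
    simp only [invPowSeries, PowerSeries.coeff_mk]
    rw [show b + 1 + (i + 1) - 1 = (b + i) + 1 by omega, show b + 1 + i - 1 = b + i by omega,
      show b + (i + 1) - 1 = b + i by omega, Nat.choose_succ_succ,
      show b + 1 + (i + 1) = b + i + 1 + 1 by omega, show b + 1 + i = b + i + 1 by omega,
      show b + (i + 1) = b + i + 1 by omega]
    push_cast
    field_simp
    ring

/-- The principal part at `0` of `f(x) / xᵃ`. -/
noncomputable def polarSum (a : ℕ) (f : PowerSeries ℝ) (x : ℝ) : ℝ :=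
  ∑ i ∈ Finset.range a, PowerSeries.coeff i f * (x ^ (a - i))⁻¹

theorem polarSum_add (a : ℕ) (f g : PowerSeries ℝ) (x : ℝ) :
    polarSum a (f + g) x = polarSum a f x + polarSum a g x := by
  simp [polarSum, add_mul, Finset.sum_add_distrib]

theorem polarSum_C_mul (a : ℕ) (c : ℝ) (f : PowerSeries ℝ) (x : ℝ) :
    polarSum a (PowerSeries.C c * f) x = c * polarSum a f x := by
  simp [polarSum, Finset.mul_sum, mul_assoc]

theorem polarSum_X_mul (a : ℕ) (f : PowerSeries ℝ) (x : ℝ) :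
    polarSum (a + 1) (PowerSeries.X * f) x = polarSum a f x := by
  simp [polarSum, Finset.sum_range_succ', PowerSeries.coeff_succ_X_mul]

theorem polarSum_one (a : ℕ) (x : ℝ) : polarSum (a + 1) 1 x = (x ^ (a + 1))⁻¹ := by
  simp [polarSum, PowerSeries.coeff_one]

/-- All exponents a - i are positive and 0⁻¹ = 0, so a principal part contributes nothing at its own
pole. -/
theorem polarSum_at_zero (a : ℕ) (f : PowerSeries ℝ) : polarSum a f 0 = 0 := by
  refine Finset.sum_eq_zero fun i hi => ?_
  rw [zero_pow (by have := Finset.mem_range.mp hi; omega)]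
  simp

/-- Multiplying the numerator of a principal part by the difference of two linear factors. -/
theorem polarSum_add_X_mul (a : ℕ) (c : ℝ) (f : PowerSeries ℝ) (x : ℝ) :
    polarSum (a + 1) ((PowerSeries.C c + PowerSeries.X) * f) x
      = c * polarSum (a + 1) f x + polarSum a f x := by
  rw [add_mul, polarSum_add, polarSum_C_mul, polarSum_X_mul]

/-- Partial fractions with two poles. -/
theorem two_pole_partialFraction (x y u : ℝ) (hx : x ≠ 0) (hy : y ≠ 0) (hu : u ≠ 0)
    (hxy : y = x + u) (a b : ℕ) (hab : a + b ≠ 0) :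
    (x ^ a)⁻¹ * (y ^ b)⁻¹
      = polarSum a (invPowSeries b u) x + polarSum b (invPowSeries a (-u)) y := by
  induction hn : a + b generalizing a b with
  | zero => omega
  | succ n ih =>
    rcases a with _ | a
    · rcases b with _ | b
      · omega
      · simp [invPowSeries_zero, polarSum]
    rcases b with _ | b
    · simp [invPowSeries_zero, polarSum]
    have h1 := ih (a + 1) b (by omega) (by omega)
    have h2 := ih a (b + 1) (by omega) (by omega)
    -- Once both sides use the series with raised exponents, `h1` and `h2` share their lower-order
    -- polar sums. These cancel in the difference and leave u times the claim.
    rw [← add_X_mul_invPowSeries b hu, polarSum_add_X_mul] at h1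
    rw [← add_X_mul_invPowSeries a (neg_ne_zero.mpr hu), polarSum_add_X_mul] at h2
    apply mul_left_cancel₀ hu
    have h3 : u * ((x ^ (a + 1))⁻¹ * (y ^ (b + 1))⁻¹)
        = (x ^ (a + 1))⁻¹ * (y ^ b)⁻¹ - (x ^ a)⁻¹ * (y ^ (b + 1))⁻¹ := by
      rw [show u = y - x by rw [hxy]; ring]
      field_simp
      ring
    rw [h3, h1, h2]
    ring

/-- Partial fractions with three poles. -/
theorem three_pole_partialFraction (x y z u v : ℝ) (hx : x ≠ 0) (hy : y ≠ 0) (hz : z ≠ 0)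
    (hu : u ≠ 0) (hv : v ≠ 0) (huv : u ≠ v)
    (hxy : y = x + u) (hxz : z = x + v) (a b c : ℕ) (hc : c ≠ 0) :
    (x ^ a)⁻¹ * (y ^ b)⁻¹ * (z ^ c)⁻¹
      = polarSum a (invPowSeries b u * invPowSeries c v) x
        + polarSum b (invPowSeries a (-u) * invPowSeries c (v - u)) y
        + polarSum c (invPowSeries a (-v) * invPowSeries b (u - v)) z := by
  induction hn : a + b generalizing a b with
  | zero =>
    obtain ⟨c, rfl⟩ := Nat.exists_eq_succ_of_ne_zero hc
    obtain ⟨rfl, rfl⟩ : a = 0 ∧ b = 0 := by omega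
    simp [invPowSeries_zero, polarSum_one]
    simp [polarSum]
  | succ n ih =>
    rcases a with _ | a
    · have h := two_pole_partialFraction y z (v - u) hy hz (sub_ne_zero.mpr huv.symm)
        (by rw [hxy, hxz]; ring) b c (by omega)
      simp only [invPowSeries_zero, pow_zero, inv_one, one_mul, h]
      simp [polarSum]
    rcases b with _ | b
    · have h := two_pole_partialFraction x z v hx hz hv hxz (a + 1) c (by omega)
      simp only [invPowSeries_zero, pow_zero, inv_one, one_mul, mul_one, h]
      simp [polarSum]
    have h1 := ih (a + 1) b (by omega)
    have h2 := ih a (b + 1) (by omega)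
    have e1 := add_X_mul_invPowSeries b hu
    have e2 := add_X_mul_invPowSeries a (neg_ne_zero.mpr hu)
    have e3 := add_X_mul_invPowSeries a (neg_ne_zero.mpr hv)
    have e4 := add_X_mul_invPowSeries b (sub_ne_zero.mpr huv)
    obtain ⟨c, rfl⟩ := Nat.exists_eq_succ_of_ne_zero hc
    -- The same cancellation as for two poles; at the pole z the surviving factor is (u - v) - (-v)
    -- = u.
    rw [← e1, ← e4, mul_left_comm (invPowSeries (a + 1) (-v)), mul_assoc (_ + _),
      polarSum_add_X_mul, polarSum_add_X_mul] at h1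
    rw [← e2, ← e3, mul_assoc (_ + _), mul_assoc (_ + _),
      polarSum_add_X_mul, polarSum_add_X_mul] at h2
    apply mul_left_cancel₀ hu
    have h3 : u * ((x ^ (a + 1))⁻¹ * (y ^ (b + 1))⁻¹ * (z ^ (c + 1))⁻¹)
        = (x ^ (a + 1))⁻¹ * (y ^ b)⁻¹ * (z ^ (c + 1))⁻¹
          - (x ^ a)⁻¹ * (y ^ (b + 1))⁻¹ * (z ^ (c + 1))⁻¹ := by
      rw [show u = y - x by rw [hxy]; ring]
      field_simp
      ring
    rw [h3, h1, h2]
    ring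

/-! ### Symmetric summation over ℤ. -/

/-- The value of the symmetric sum `∑_{n ≠ 0} n⁻ⁱ`. -/
noncomputable def symmZeta (i : ℕ) : ℝ := (1 + (-1) ^ i) * zetaValue i

theorem zetaValue_mem {s : ℕ} (hs : 2 ≤ s) : zetaValue s ∈ zetaAlgebra :=
  Algebra.subset_adjoin ⟨s, hs, rfl⟩

theorem neg_one_pow_mem (i : ℕ) : (-1 : ℝ) ^ i ∈ zetaAlgebra :=
  pow_mem (neg_mem (one_mem _)) i

/-- At i = 1 the sign factor vanishes, so the divergent ζ(1) plays no role. -/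
theorem symmZeta_mem {i : ℕ} (hi : i ≠ 0) : symmZeta i ∈ zetaAlgebra := by
  rcases eq_or_ne i 1 with rfl | h
  · simp [symmZeta, zero_mem]
  · exact mul_mem (add_mem (one_mem _) (neg_one_pow_mem i)) (zetaValue_mem (by omega))

theorem summable_zetaValue {s : ℕ} (hs : 2 ≤ s) :
    Summable fun n : ℕ => (((n : ℝ) + 1) ^ s)⁻¹ := by
  have := (summable_nat_add_iff 1).mpr (Real.summable_nat_pow_inv.mpr (show 1 < s by omega))
  simpa using this

theorem hasSum_zetaValue {s : ℕ} (hs : 2 ≤ s) :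
    HasSum (fun n : ℕ => (((n : ℝ) + 1) ^ s)⁻¹) (zetaValue s) := by
  simpa [zetaValue] using (summable_zetaValue hs).hasSum

/-- Convergence of the symmetric partial sums of a doubly infinite series. -/
def HasSymmSum (f : ℤ → ℝ) (s : ℝ) : Prop :=
  Tendsto (fun N : ℕ => ∑ n ∈ Finset.Icc (-(N : ℤ)) N, f n) atTop (𝓝 s)

theorem HasSymmSum.add {f g : ℤ → ℝ} {s t : ℝ} (hf : HasSymmSum f s) (hg : HasSymmSum g t) :
    HasSymmSum (fun n => f n + g n) (s + t) := by
  simpa only [HasSymmSum, Finset.sum_add_distrib] using Tendsto.add hf hg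

theorem HasSymmSum.sub {f g : ℤ → ℝ} {s t : ℝ} (hf : HasSymmSum f s) (hg : HasSymmSum g t) :
    HasSymmSum (fun n => f n - g n) (s - t) := by
  simpa only [HasSymmSum, Finset.sum_sub_distrib] using Tendsto.sub hf hg

theorem HasSymmSum.const_mul {f : ℤ → ℝ} {s : ℝ} (c : ℝ) (hf : HasSymmSum f s) :
    HasSymmSum (fun n => c * f n) (c * s) := by
  simpa only [HasSymmSum, Finset.mul_sum] using Tendsto.const_mul c hf

theorem hasSymmSum_sum {ι : Type*} (t : Finset ι) {f : ι → ℤ → ℝ} {s : ι → ℝ}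
    (h : ∀ i ∈ t, HasSymmSum (f i) (s i)) :
    HasSymmSum (fun n => ∑ i ∈ t, f i n) (∑ i ∈ t, s i) := by
  have := tendsto_finsetSum t h
  unfold HasSymmSum
  simpa only [Finset.sum_comm (s := t)] using this

theorem tendsto_Icc_neg_atTop :
    Tendsto (fun N : ℕ => Finset.Icc (-(N : ℤ)) N) atTop atTop := by
  refine tendsto_atTop_finset_of_monotone (fun M N h => ?_) fun x => ⟨x.natAbs, ?_⟩
  · exact Finset.Icc_subset_Icc (by omega) (by omega)
  · rw [Finset.mem_Icc]; omega

theorem _root_.HasSum.hasSymmSum {f : ℤ → ℝ} {s : ℝ} (h : HasSum f s) : HasSymmSum f s := by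
  rw [HasSum, SummationFilter.unconditional_filter] at h
  exact h.comp tendsto_Icc_neg_atTop

theorem HasSymmSum.unique {f : ℤ → ℝ} {s t : ℝ} (hf : HasSymmSum f s) (hg : HasSymmSum f t) :
    s = t := tendsto_nhds_unique hf hg

theorem sum_Icc_neg_succ (f : ℤ → ℝ) (N : ℕ) :
    ∑ n ∈ Finset.Icc (-((N + 1 : ℕ) : ℤ)) (N + 1 : ℕ), f n
      = ∑ n ∈ Finset.Icc (-(N : ℤ)) N, f n + f (N + 1) + f (-(N + 1)) := by
  have h : Finset.Icc (-((N + 1 : ℕ) : ℤ)) (N + 1 : ℕ)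
      = insert (-((N : ℤ) + 1)) (insert ((N : ℤ) + 1) (Finset.Icc (-(N : ℤ)) N)) := by
    ext x
    simp only [Finset.mem_insert, Finset.mem_Icc]
    push_cast
    omega
  rw [h, Finset.sum_insert (by simp; omega), Finset.sum_insert (by simp)]
  ring

theorem sum_Icc_neg_shift (f : ℤ → ℝ) (N : ℕ) :
    ∑ n ∈ Finset.Icc (-(N : ℤ)) N, f (n + 1)
      = ∑ n ∈ Finset.Icc (-(N : ℤ)) N, f n + f (N + 1) - f (-N) := by
  induction N with
  | zero => simp
  | succ N ih =>
    rw [sum_Icc_neg_succ, sum_Icc_neg_succ, ih]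
    push_cast
    rw [show -((N : ℤ) + 1) + 1 = -N by ring]
    ring

/-- Simple poles give only conditionally convergent sums, so translation invariance needs an
argument: a unit shift changes the partial sum by two end terms, which tend to 0. -/
theorem HasSymmSum.shift {f : ℤ → ℝ} {s : ℝ} (h1 : Tendsto f atTop (𝓝 0))
    (h2 : Tendsto f atBot (𝓝 0)) (h : HasSymmSum f s) (e : ℤ) :
    HasSymmSum (fun n => f (n + e)) s := by
  have hN := tendsto_natCast_atTop_atTop (R := ℤ)
  have key (e : ℤ) : Tendsto (fun N : ℕ => f (N + 1 + e) - f (-N + e)) atTop (𝓝 0) := by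
    have a1 := h1.comp (tendsto_atTop_add_const_right _ e (tendsto_atTop_add_const_right _ 1 hN))
    have a2 := h2.comp (tendsto_atBot_add_const_right _ e (tendsto_neg_atTop_atBot.comp hN))
    simpa using a1.sub a2
  have step (e : ℤ) (N : ℕ) : ∑ n ∈ Finset.Icc (-(N : ℤ)) N, f (n + (e + 1))
      = ∑ n ∈ Finset.Icc (-(N : ℤ)) N, f (n + e) + (f (N + 1 + e) - f (-N + e)) := by
    have := sum_Icc_neg_shift (fun n => f (n + e)) N
    simp only [add_assoc, add_comm (1 : ℤ) e] at this ⊢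
    rw [this]; ring
  induction e with
  | zero => simpa using h
  | succ e ih =>
    unfold HasSymmSum at ih ⊢
    simp only [step]
    simpa using ih.add (key e)
  | pred e ih =>
    unfold HasSymmSum at ih ⊢
    have hs := fun N => step (-(e : ℤ) - 1) N
    simp only [sub_add_cancel] at hs
    simp only [hs] at ih
    simpa using ih.sub (key (-(e : ℤ) - 1))

theorem inv_neg_pow (x : ℝ) (i : ℕ) : ((-x) ^ i)⁻¹ = (-1) ^ i * (x ^ i)⁻¹ := by
  rw [← inv_pow, inv_neg, neg_pow, inv_pow]

theorem hasSymmSum_inv_pow {i : ℕ} (hi : i ≠ 0) :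
    HasSymmSum (fun n => ((n : ℝ) ^ i)⁻¹) (symmZeta i) := by
  have h (N : ℕ) : ∑ n ∈ Finset.Icc (-(N : ℤ)) N, ((n : ℝ) ^ i)⁻¹
      = (1 + (-1) ^ i) * ∑ j ∈ Finset.range N, (((j : ℝ) + 1) ^ i)⁻¹ := by
    induction N with
    | zero => simp [hi]
    | succ N ih =>
      rw [sum_Icc_neg_succ, ih, Finset.sum_range_succ]
      push_cast
      rw [inv_neg_pow]
      ring
  unfold HasSymmSum
  simp only [h]
  rcases eq_or_ne i 1 with rfl | h1
  · simp [symmZeta]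
  · exact ((hasSum_zetaValue (show 2 ≤ i by omega)).tendsto_sum_nat).const_mul _

theorem hasSymmSum_inv_sub_pow {i : ℕ} (hi : i ≠ 0) (e : ℤ) :
    HasSymmSum (fun n => (((n : ℝ) - e) ^ i)⁻¹) (symmZeta i) := by
  have h1 : Tendsto (fun n : ℤ => ((n : ℝ) ^ i)⁻¹) atTop (𝓝 0) :=
    (tendsto_inv_atTop_zero.comp (tendsto_pow_atTop hi)).comp tendsto_intCast_atTop_atTop
  have h2 : Tendsto (fun n : ℤ => ((n : ℝ) ^ i)⁻¹) atBot (𝓝 0) := by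
    have := (h1.comp tendsto_neg_atBot_atTop).const_mul ((-1) ^ i)
    rw [mul_zero] at this
    refine this.congr fun n => ?_
    simp only [Function.comp_apply, Int.cast_neg]
    rw [inv_neg_pow, ← mul_assoc, ← mul_pow]
    simp
  simpa [sub_eq_add_neg] using (hasSymmSum_inv_pow hi).shift h1 h2 (-e)

theorem hasSymmSum_polarSum (a : ℕ) (f : PowerSeries ℝ) (e : ℤ) :
    HasSymmSum (fun n => polarSum a f ((n : ℝ) - e))
      (∑ i ∈ Finset.range a, PowerSeries.coeff i f * symmZeta (a - i)) := by
  refine hasSymmSum_sum _ fun i hi => (hasSymmSum_inv_sub_pow ?_ e).const_mul _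
  have := Finset.mem_range.mp hi
  omega

/-- If `f` vanishes on the finite set `E` and agrees with `g` off `E`, then the symmetric sum of `f`
is that of `g` without the terms in `E`. -/
theorem tsum_eq_of_hasSymmSum {f g : ℤ → ℝ} {s : ℝ} (E : Finset ℤ) (hf : Summable f)
    (h0 : ∀ n ∈ E, f n = 0) (h1 : ∀ n ∉ E, f n = g n) (hg : HasSymmSum g s) :
    ∑' n, f n = s - ∑ n ∈ E, g n := by
  have hE : HasSum (fun n => if n ∈ E then g n else 0) (∑ n ∈ E, g n) := by
    have := hasSum_sum_of_ne_finset_zero (L := .unconditional ℤ)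
      (f := fun n => if n ∈ E then g n else 0) (s := E)
      (fun n hn => by simp [hn])
    rwa [Finset.sum_congr rfl fun n hn => if_pos hn] at this
  refine hf.hasSum.hasSymmSum.unique ?_
  convert hg.sub hE.hasSymmSum using 2 with n
  by_cases hn : n ∈ E
  · simp [hn, h0]
  · simp [hn, h1]

/-! ### Row sums over k, and absolute convergence of the multiple series. -/

theorem hasSum_congr {ι : Type*} {f g : ι → ℝ} {s : ℝ} (h : ∀ i, f i = g i) :
    HasSum f s ↔ HasSum g s := by
  rw [funext h]

theorem genHarmonic_zero (r : ℕ) : genHarmonic r 0 = 0 := by simp [genHarmonic]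

theorem genHarmonic_succ (r n : ℕ) :
    genHarmonic r (n + 1) = genHarmonic r n + (((n : ℝ) + 1) ^ r)⁻¹ := by
  rw [genHarmonic, Finset.sum_Icc_succ_top (by omega), ← genHarmonic]
  simp

theorem hasSum_eulerSum (π : Multiset ℕ) (hπ : ∀ p ∈ π, 1 ≤ p) (q : ℕ) (hq : 2 ≤ q) :
    HasSum (fun n : ℕ => (π.map (fun p => genHarmonic p (n + 1))).prod * (((n : ℝ) + 1) ^ q)⁻¹)
      (eulerSum π q) := by
  simpa only [eulerSum, div_eq_mul_inv] using (summable_eulerSum π hπ q hq).hasSum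

theorem hasSum_linear_eulerSum {p q : ℕ} (hp : 1 ≤ p) (hq : 2 ≤ q) :
    HasSum (fun n : ℕ => genHarmonic p (n + 1) * (((n : ℝ) + 1) ^ q)⁻¹) (eulerSum {p} q) := by
  simpa using hasSum_eulerSum {p} (by simpa using hp) q hq

theorem eulerSum_mem {p q : ℕ} (hp : 1 ≤ p) (hq : 2 ≤ q) : eulerSum {p} q ∈ linearReducible :=
  Submodule.subset_span (Or.inr ⟨p, q, hp, hq, rfl⟩)

theorem mul_mem_linearReducible {z x : ℝ} (hz : z ∈ zetaAlgebra) (hx : x ∈ linearReducible) :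
    z * x ∈ linearReducible :=
  linearReducible.smul_mem ⟨z, hz⟩ hx

theorem mem_linearReducible_of_mem {z : ℝ} (hz : z ∈ zetaAlgebra) : z ∈ linearReducible := by
  simpa using mul_mem_linearReducible hz (Submodule.subset_span (Or.inl rfl))

theorem ratCast_mem (q : ℚ) : (q : ℝ) ∈ zetaAlgebra := zetaAlgebra.algebraMap_mem q

/-- One step of the recursion in `n` for `∑_{k ≥ 1} (n - k)⁻ᵝ`. -/
theorem hasSum_row_step (β : ℕ) (x s : ℝ) :
    HasSum (fun k : ℕ => ((x - (k + 1)) ^ β)⁻¹) s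
      ↔ HasSum (fun k : ℕ => ((x + 1 - (k + 1)) ^ β)⁻¹) (s + (x ^ β)⁻¹) := by
  rw [← hasSum_nat_add_iff' (f := fun k : ℕ => ((x + 1 - (k + 1)) ^ β)⁻¹) 1]
  simp only [Finset.sum_range_one, Nat.cast_add, Nat.cast_one, Nat.cast_zero, zero_add,
    add_sub_cancel_right]
  simp only [add_sub_add_right_eq_sub]

theorem hasSum_row_zero {β : ℕ} (hβ : 2 ≤ β) :
    HasSum (fun k : ℕ => (((0 : ℝ) - (k + 1)) ^ β)⁻¹) ((-1) ^ β * zetaValue β) := by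
  simpa only [zero_sub, inv_neg_pow] using (hasSum_zetaValue hβ).mul_left ((-1) ^ β)

/-- The term k = m is 1/0 = 0; earlier terms give the harmonic number with index m, not m + 1, and
later ones give ±ζ(β). -/
theorem hasSum_row_pos {β : ℕ} (hβ : 2 ≤ β) (m : ℕ) :
    HasSum (fun k : ℕ => (((m : ℝ) + 1 - (k + 1)) ^ β)⁻¹)
      ((-1) ^ β * zetaValue β + genHarmonic β m) := by
  induction m with
  | zero =>
    have := (hasSum_row_step β 0 _).mp (hasSum_row_zero hβ)
    simpa [genHarmonic_zero, show β ≠ 0 by omega] using this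
  | succ m ih =>
    have := (hasSum_row_step β _ _).mp ih
    rw [genHarmonic_succ, ← add_assoc]
    simpa using this

theorem hasSum_row_neg {β : ℕ} (hβ : 2 ≤ β) (m : ℕ) :
    HasSum (fun k : ℕ => ((-(m : ℝ) - (k + 1)) ^ β)⁻¹)
      ((-1) ^ β * (zetaValue β - genHarmonic β m)) := by
  induction m with
  | zero => simpa [genHarmonic_zero] using hasSum_row_zero hβ
  | succ m ih =>
    rw [hasSum_row_step]
    convert ih using 2
    · push_cast; ring_nf
    · rw [genHarmonic_succ, inv_neg_pow]; push_cast; ring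

theorem summable_int_inv_pow {i : ℕ} (hi : 2 ≤ i) : Summable fun n : ℤ => ((n : ℝ) ^ i)⁻¹ := by
  simpa using Real.summable_one_div_int_pow.mpr (show 1 < i by omega)

theorem hasSum_int_of_zero {f : ℤ → ℝ} {s t : ℝ} (h0 : f 0 = 0)
    (h1 : HasSum (fun n : ℕ => f (n + 1)) s) (h2 : HasSum (fun n : ℕ => f (-(n + 1))) t) :
    HasSum f (s + t) := by
  refine HasSum.of_nat_of_neg_add_one ?_ h2
  rw [← hasSum_nat_add_iff' 1]
  simpa [h0] using h1

theorem summable_int_double {a c : ℕ} (ha : 2 ≤ a) (hc : 2 ≤ c) :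
    Summable fun p : ℤ × ℤ => ((p.1 : ℝ) ^ c)⁻¹ * ((p.2 : ℝ) ^ a)⁻¹ :=
  summable_mul_of_summable_norm (summable_int_inv_pow hc).norm (summable_int_inv_pow ha).norm

/-- The map (n, k) ↦ (n, n - k - 1) embeds the index set in ℤ × ℤ, where the series is a product of
two absolutely convergent ones. -/
theorem summable_double {a c : ℕ} (ha : 2 ≤ a) (hc : 2 ≤ c) :
    Summable fun p : ℤ × ℕ => ((p.1 : ℝ) ^ c)⁻¹ * (((p.1 : ℝ) - (p.2 + 1)) ^ a)⁻¹ := by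
  have hi : Function.Injective fun p : ℤ × ℕ => (p.1, p.1 - (p.2 + 1)) := by
    rintro ⟨n, k⟩ ⟨n', k'⟩ h
    simp only [Prod.mk.injEq] at h ⊢
    omega
  simpa [Function.comp_def] using (summable_int_double ha hc).comp_injective hi

theorem summable_triple {a b c : ℕ} (ha : 2 ≤ a) (hb : 2 ≤ b) (hc : 2 ≤ c) :
    Summable fun p : ℤ × (ℕ × ℕ) => ((p.1 : ℝ) ^ c)⁻¹ *
      ((((p.1 : ℝ) - (p.2.1 + 1)) ^ a)⁻¹ * (((p.1 : ℝ) - (p.2.2 + 1)) ^ b)⁻¹) := by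
  have hi : Function.Injective
      fun p : ℤ × (ℕ × ℕ) => (p.1, (p.1 - (p.2.1 + 1), p.1 - (p.2.2 + 1))) := by
    rintro ⟨n, k, l⟩ ⟨n', k', l'⟩ h
    simp only [Prod.mk.injEq] at h ⊢
    omega
  have := (summable_mul_of_summable_norm (summable_int_inv_pow hc).norm
    (summable_int_double hb ha).norm).comp_injective hi
  simpa [Function.comp_def] using this

/-- The double sum `∑_{n ∈ ℤ, k ≥ 1} n⁻ᶜ (n - k)⁻ᵃ`, summed over `k` first. -/
theorem hasSum_double {a c : ℕ} (ha : 2 ≤ a) (hc : 2 ≤ c) :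
    HasSum (fun p : ℤ × ℕ => ((p.1 : ℝ) ^ c)⁻¹ * (((p.1 : ℝ) - (p.2 + 1)) ^ a)⁻¹)
      (((-1) ^ a * zetaValue a * zetaValue c + eulerSum {a} c - zetaValue (a + c))
        + (-1) ^ (a + c) * (zetaValue a * zetaValue c - eulerSum {a} c)) := by
  have hs := (summable_double ha hc).hasSum
  have h0 := hasSum_zetaValue hc
  have h1 := hasSum_linear_eulerSum (show 1 ≤ a by omega) hc
  have h2 := hasSum_zetaValue (show 2 ≤ a + c by omega)
  have key : HasSum (fun n : ℤ => ∑' k : ℕ, ((n : ℝ) ^ c)⁻¹ * (((n : ℝ) - (k + 1)) ^ a)⁻¹)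
      (((-1) ^ a * zetaValue a * zetaValue c + eulerSum {a} c - zetaValue (a + c))
        + (-1) ^ (a + c) * (zetaValue a * zetaValue c - eulerSum {a} c)) := by
    refine hasSum_int_of_zero (by simp [show c ≠ 0 by omega]) ?_ ?_
    · refine (hasSum_congr fun n => ?_).mpr (((h0.mul_left ((-1) ^ a * zetaValue a)).add h1).sub h2)
      rw [tsum_mul_left]
      push_cast
      rw [(hasSum_row_pos ha n).tsum_eq, genHarmonic_succ, pow_add, mul_inv]
      ring
    · refine (hasSum_congr fun n => ?_).mpr
        (((h0.mul_left (zetaValue a)).sub h1).mul_left ((-1) ^ (a + c)))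
      rw [tsum_mul_left]
      have := (hasSum_row_neg ha (n + 1)).tsum_eq
      push_cast at this ⊢
      rw [this, inv_neg_pow, pow_add]
      ring
  rw [← key.tsum_eq, ← (summable_double ha hc).tsum_prod]
  exact hs

/-! ### Closure of convergent families under the expressions produced by partial fractions. -/

/-- The families of real numbers whose sum converges to an element of `M`. -/
def seriesIn (ι : Type*) (M : Submodule zetaAlgebra ℝ) : Submodule zetaAlgebra (ι → ℝ) where
  carrier := {f | Summable f ∧ ∑' i, f i ∈ M}
  zero_mem' := ⟨summable_zero, by simp⟩
  add_mem' := fun {f g} hf hg => ⟨hf.1.add hg.1, by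
    simpa only [Pi.add_apply, hf.1.tsum_add hg.1] using M.add_mem hf.2 hg.2⟩
  smul_mem' := fun z f hf => by
    have h : z • f = fun i => (z : ℝ) * f i := rfl
    refine ⟨h ▸ hf.1.mul_left _, ?_⟩
    rw [h, tsum_mul_left]
    exact M.smul_mem z hf.2

theorem mem_seriesIn_of_hasSum {ι : Type*} {M : Submodule zetaAlgebra ℝ} {f : ι → ℝ} {s : ℝ}
    (h : HasSum f s) (hs : s ∈ M) : f ∈ seriesIn ι M :=
  ⟨h.summable, h.tsum_eq.symm ▸ hs⟩

theorem mul_mem_submodule {ι : Type*} (N : Submodule zetaAlgebra (ι → ℝ)) {z : ℝ}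
    (hz : z ∈ zetaAlgebra) {f : ι → ℝ} (hf : f ∈ N) : (fun i => z * f i) ∈ N :=
  N.smul_mem ⟨z, hz⟩ hf

section Poles

variable {ι : Type*} (N : Submodule zetaAlgebra (ι → ℝ)) {w s t : ι → ℝ} {b c : ℕ}

/-- The coefficient is an integer combination of s^(-(b+j)) t^(-(c+i-j)). Exponents only grow, so
`H` still applies; γ and δ absorb the extra powers from principal parts evaluated at -s or -t. -/
theorem coeff_invPowSeries_mul_mem
    (H : ∀ α ≥ b, ∀ β ≥ c, (fun p => w p * ((s p ^ α)⁻¹ * (t p ^ β)⁻¹)) ∈ N) (i γ δ : ℕ) :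
    (fun p => w p * (PowerSeries.coeff i (invPowSeries b (s p) * invPowSeries c (t p))
      * ((s p ^ γ)⁻¹ * (t p ^ δ)⁻¹))) ∈ N := by
  have h (p : ι) : w p * (PowerSeries.coeff i (invPowSeries b (s p) * invPowSeries c (t p))
      * ((s p ^ γ)⁻¹ * (t p ^ δ)⁻¹)) = ∑ x ∈ Finset.HasAntidiagonal.antidiagonal i,
      ((-1) ^ x.1 * ((b + x.1 - 1).choose x.1 : ℝ) * ((-1) ^ x.2 * ((c + x.2 - 1).choose x.2 : ℝ)))
        * (w p * ((s p ^ (b + x.1 + γ))⁻¹ * (t p ^ (c + x.2 + δ))⁻¹)) := by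
    rw [PowerSeries.coeff_mul, Finset.sum_mul, Finset.mul_sum]
    refine Finset.sum_congr rfl fun x _ => ?_
    simp only [invPowSeries, PowerSeries.coeff_mk, pow_add, mul_inv]
    ring
  simp only [h]
  have h2 := N.sum_mem (t := Finset.HasAntidiagonal.antidiagonal i)
    (f := fun x p => ((-1) ^ x.1 * ((b + x.1 - 1).choose x.1 : ℝ)
      * ((-1) ^ x.2 * ((c + x.2 - 1).choose x.2 : ℝ)))
        * (w p * ((s p ^ (b + x.1 + γ))⁻¹ * (t p ^ (c + x.2 + δ))⁻¹))) fun x _ =>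
    mul_mem_submodule N (mul_mem (mul_mem (neg_one_pow_mem _) (natCast_mem _ _))
      (mul_mem (neg_one_pow_mem _) (natCast_mem _ _))) (H _ (by omega) _ (by omega))
  convert h2 using 1
  ext p
  simp

theorem sum_coeff_mul_symmZeta_mem
    (H : ∀ α ≥ b, ∀ β ≥ c, (fun p => w p * ((s p ^ α)⁻¹ * (t p ^ β)⁻¹)) ∈ N) (a : ℕ) :
    (fun p => w p * ∑ i ∈ Finset.range a,
      PowerSeries.coeff i (invPowSeries b (s p) * invPowSeries c (t p)) * symmZeta (a - i)) ∈ N := by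
  have h2 := N.sum_mem (t := Finset.range a) fun i hi =>
    mul_mem_submodule N (symmZeta_mem (i := a - i) (by have := Finset.mem_range.mp hi; omega))
      (coeff_invPowSeries_mul_mem N H i 0 0)
  convert h2 using 1
  ext p
  simp only [Finset.mul_sum, Finset.sum_apply]
  refine Finset.sum_congr rfl fun i _ => ?_
  simp only [pow_zero, inv_one]
  ring

theorem polarSum_neg_left_mem
    (H : ∀ α ≥ b, ∀ β ≥ c, (fun p => w p * ((s p ^ α)⁻¹ * (t p ^ β)⁻¹)) ∈ N) (a : ℕ) :
    (fun p => w p * polarSum a (invPowSeries b (s p) * invPowSeries c (t p)) (-s p)) ∈ N := by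
  have h2 := N.sum_mem (t := Finset.range a) fun i _ =>
    mul_mem_submodule N (neg_one_pow_mem (a - i)) (coeff_invPowSeries_mul_mem N H i (a - i) 0)
  convert h2 using 1
  ext p
  simp only [polarSum, Finset.mul_sum, Finset.sum_apply, inv_neg_pow]
  refine Finset.sum_congr rfl fun i _ => ?_
  simp only [pow_zero, inv_one]
  ring

theorem polarSum_neg_right_mem
    (H : ∀ α ≥ b, ∀ β ≥ c, (fun p => w p * ((s p ^ α)⁻¹ * (t p ^ β)⁻¹)) ∈ N) (a : ℕ) :
    (fun p => w p * polarSum a (invPowSeries b (s p) * invPowSeries c (t p)) (-t p)) ∈ N := by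
  have h2 := N.sum_mem (t := Finset.range a) fun i _ =>
    mul_mem_submodule N (neg_one_pow_mem (a - i)) (coeff_invPowSeries_mul_mem N H i 0 (a - i))
  convert h2 using 1
  ext p
  simp only [polarSum, Finset.mul_sum, Finset.sum_apply, inv_neg_pow]
  refine Finset.sum_congr rfl fun i _ => ?_
  simp only [pow_zero, inv_one]
  ring

end Poles

/-! ### Double series over k ≠ l. -/

theorem tsum_prod_swap {α β : Type*} {f : α × β → ℝ} (h : Summable f) :
    ∑' p, f p = ∑' b, ∑' a, f (a, b) := by
  rw [← (Equiv.prodComm β α).tsum_eq f]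
  exact h.prod_symm.tsum_prod

theorem hasSum_diagonal {f : ℕ → ℝ} {s : ℝ} (h : HasSum f s) :
    HasSum (fun p : ℕ × ℕ => if p.1 = p.2 then f p.1 else 0) s := by
  have hi : Function.Injective fun n : ℕ => (n, n) := fun m n h => by simpa using h
  refine (hi.hasSum_iff ?_).mp (by simpa [Function.comp_def] using h)
  rintro ⟨k, l⟩ hkl
  refine if_neg fun h : k = l => hkl ⟨k, by simp [h]⟩

/-- The indicator function of the complement of the diagonal. -/
noncomputable def offDiag (p : ℕ × ℕ) : ℝ := if p.1 = p.2 then 0 else 1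

theorem offDiag_product_mem {α β : ℕ} (hα : 2 ≤ α) (hβ : 2 ≤ β) :
    (fun p : ℕ × ℕ => offDiag p * ((((p.1 : ℝ) + 1) ^ α)⁻¹ * (((p.2 : ℝ) + 1) ^ β)⁻¹))
      ∈ seriesIn (ℕ × ℕ) linearReducible := by
  have h1 := (hasSum_zetaValue hα).mul (hasSum_zetaValue hβ)
    (summable_mul_of_summable_norm (summable_zetaValue hα).norm (summable_zetaValue hβ).norm)
  have h2 := hasSum_diagonal (hasSum_zetaValue (show 2 ≤ α + β by omega))
  refine mem_seriesIn_of_hasSum ((hasSum_congr fun p => ?_).mpr (h1.sub h2))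
    (mem_linearReducible_of_mem (sub_mem (mul_mem (zetaValue_mem hα) (zetaValue_mem hβ))
      (zetaValue_mem (by omega))))
  unfold offDiag
  split_ifs with h
  · rw [h, pow_add, mul_inv]; ring
  · ring

/-- Summing over l first gives a row sum, that is ±ζ(β) plus a harmonic number. This is where linear
Euler sums enter when the triple sum is taken over n first. -/
theorem offDiag_difference_mem {α β : ℕ} (hα : 2 ≤ α) (hβ : 2 ≤ β) :
    (fun p : ℕ × ℕ => offDiag p * ((((p.1 : ℝ) + 1) ^ α)⁻¹ * (((p.1 : ℝ) - p.2) ^ β)⁻¹))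
      ∈ seriesIn (ℕ × ℕ) linearReducible := by
  have h0 (p : ℕ × ℕ) : offDiag p * ((((p.1 : ℝ) + 1) ^ α)⁻¹ * (((p.1 : ℝ) - p.2) ^ β)⁻¹)
      = (((p.1 : ℝ) + 1) ^ α)⁻¹ * (((p.1 : ℝ) - p.2) ^ β)⁻¹ := by
    unfold offDiag
    split_ifs with h
    · simp [h, show β ≠ 0 by omega]
    · simp
  simp only [h0]
  have hi : Function.Injective fun p : ℕ × ℕ => ((p.1 : ℤ) + 1, (p.1 : ℤ) - p.2) := by
    rintro ⟨k, l⟩ ⟨k', l'⟩ h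
    simp only [Prod.mk.injEq] at h ⊢
    omega
  have hs : Summable fun p : ℕ × ℕ => (((p.1 : ℝ) + 1) ^ α)⁻¹ * (((p.1 : ℝ) - p.2) ^ β)⁻¹ := by
    simpa [Function.comp_def] using (summable_int_double hβ hα).comp_injective hi
  refine ⟨hs, ?_⟩
  have key := ((((hasSum_zetaValue hα).mul_left ((-1) ^ β * zetaValue β)).add
    (hasSum_linear_eulerSum (show 1 ≤ β by omega) hα)).sub
      (hasSum_zetaValue (show 2 ≤ α + β by omega))).tsum_eq
  rw [hs.tsum_prod]
  have hr (k : ℕ) : ∑' l : ℕ, (((k : ℝ) + 1) ^ α)⁻¹ * (((k : ℝ) - l) ^ β)⁻¹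
      = (-1) ^ β * zetaValue β * (((k : ℝ) + 1) ^ α)⁻¹
        + genHarmonic β (k + 1) * (((k : ℝ) + 1) ^ α)⁻¹ - (((k : ℝ) + 1) ^ (α + β))⁻¹ := by
    have := (hasSum_row_pos hβ k).tsum_eq
    simp only [add_sub_add_right_eq_sub] at this
    rw [tsum_mul_left, this, genHarmonic_succ, pow_add, mul_inv]
    ring
  simp only [hr]
  rw [key]
  exact sub_mem (add_mem (mem_linearReducible_of_mem (mul_mem (mul_mem (neg_one_pow_mem _)
    (zetaValue_mem hβ)) (zetaValue_mem hα))) (eulerSum_mem (by omega) hα))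
    (mem_linearReducible_of_mem (zetaValue_mem (by omega)))

theorem offDiag_difference_swap_mem {α β : ℕ} (hα : 2 ≤ α) (hβ : 2 ≤ β) :
    (fun p : ℕ × ℕ => offDiag p * ((((p.2 : ℝ) + 1) ^ α)⁻¹ * (((p.2 : ℝ) - p.1) ^ β)⁻¹))
      ∈ seriesIn (ℕ × ℕ) linearReducible := by
  obtain ⟨h1, h2⟩ := offDiag_difference_mem hα hβ
  have h := mem_seriesIn_of_hasSum ((Equiv.prodComm ℕ ℕ).hasSum_iff.mpr h1.hasSum) h2
  convert h using 2 with p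
  simp [offDiag, eq_comm]

/-! ### Summation over n first. -/

/-- The summand is 0 at n = 0 and n = K because 0⁻¹ = 0, but its partial fraction expansion need not
be; the subtracted terms are the values of that expansion there. -/
theorem tsum_two_pole {K : ℤ} (hK : K ≠ 0) {a c : ℕ} (ha : a ≠ 0) (hc : c ≠ 0)
    (hs : Summable fun n : ℤ => ((n : ℝ) ^ c)⁻¹ * (((n : ℝ) - K) ^ a)⁻¹) :
    ∑' n : ℤ, ((n : ℝ) ^ c)⁻¹ * (((n : ℝ) - K) ^ a)⁻¹
      = (∑ i ∈ Finset.range c, PowerSeries.coeff i (invPowSeries a (-K)) * symmZeta (c - i)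
        + ∑ i ∈ Finset.range a, PowerSeries.coeff i (invPowSeries c K) * symmZeta (a - i))
        - (polarSum a (invPowSeries c K) (-K) + polarSum c (invPowSeries a (-K)) K) := by
  have hg := (hasSymmSum_polarSum c (invPowSeries a (-K)) 0).add
    (hasSymmSum_polarSum a (invPowSeries c K) K)
  have hK' : (K : ℝ) ≠ 0 := by exact_mod_cast hK
  rw [tsum_eq_of_hasSymmSum {0, K} hs ?_ ?_ hg]
  · rw [Finset.sum_pair hK.symm]
    simp [polarSum_at_zero]
  · intro n hn
    rcases Finset.mem_insert.mp hn with rfl | hn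
    · simp [hc]
    · rw [Finset.mem_singleton.mp hn]
      simp [ha]
  · intro n hn
    simp only [Finset.mem_insert, Finset.mem_singleton, not_or] at hn
    have h1 : (n : ℝ) ≠ 0 := by exact_mod_cast hn.1
    have h2 : (n : ℝ) - K ≠ 0 := sub_ne_zero.mpr (by exact_mod_cast hn.2)
    simpa using two_pole_partialFraction n (n - K) (-K) h1 h2 (neg_ne_zero.mpr hK')
      (sub_eq_add_neg _ _) c a (by omega)

theorem tsum_three_pole {K L : ℤ} (hK : K ≠ 0) (hL : L ≠ 0) (hKL : K ≠ L) {a b c : ℕ}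
    (ha : a ≠ 0) (hb : b ≠ 0) (hc : c ≠ 0)
    (hs : Summable fun n : ℤ =>
      ((n : ℝ) ^ c)⁻¹ * ((((n : ℝ) - K) ^ a)⁻¹ * (((n : ℝ) - L) ^ b)⁻¹)) :
    ∑' n : ℤ, ((n : ℝ) ^ c)⁻¹ * ((((n : ℝ) - K) ^ a)⁻¹ * (((n : ℝ) - L) ^ b)⁻¹)
      = (∑ i ∈ Finset.range c,
            PowerSeries.coeff i (invPowSeries a (-K) * invPowSeries b (-L)) * symmZeta (c - i)
          + ∑ i ∈ Finset.range a,
            PowerSeries.coeff i (invPowSeries c K * invPowSeries b (K - L)) * symmZeta (a - i)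
          + ∑ i ∈ Finset.range b,
            PowerSeries.coeff i (invPowSeries c L * invPowSeries a (L - K)) * symmZeta (b - i))
        - ((polarSum a (invPowSeries c K * invPowSeries b (K - L)) (-K)
            + polarSum b (invPowSeries c L * invPowSeries a (L - K)) (-L))
          + ((polarSum c (invPowSeries a (-K) * invPowSeries b (-L)) K
              + polarSum b (invPowSeries c L * invPowSeries a (L - K)) (-(L - K)))
            + (polarSum c (invPowSeries a (-K) * invPowSeries b (-L)) L
              + polarSum a (invPowSeries c K * invPowSeries b (K - L)) (-(K - L))))) := by
  have hg := ((hasSymmSum_polarSum c (invPowSeries a (-K) * invPowSeries b (-L)) 0).add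
    (hasSymmSum_polarSum a (invPowSeries c K * invPowSeries b (K - L)) K)).add
    (hasSymmSum_polarSum b (invPowSeries c L * invPowSeries a (L - K)) L)
  have hK' : (K : ℝ) ≠ 0 := by exact_mod_cast hK
  have hL' : (L : ℝ) ≠ 0 := by exact_mod_cast hL
  have hKL' : (K : ℝ) ≠ L := by exact_mod_cast hKL
  rw [tsum_eq_of_hasSymmSum {0, K, L} hs ?_ ?_ hg]
  · rw [Finset.sum_insert (by simp [hK.symm, hL.symm]), Finset.sum_pair hKL]
    simp [polarSum_at_zero]
  · intro n hn
    simp only [Finset.mem_insert, Finset.mem_singleton] at hn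
    rcases hn with rfl | rfl | rfl
    · simp [hc]
    · simp [ha]
    · simp [hb]
  · intro n hn
    simp only [Finset.mem_insert, Finset.mem_singleton, not_or] at hn
    have h1 : (n : ℝ) ≠ 0 := by exact_mod_cast hn.1
    have h2 : (n : ℝ) - K ≠ 0 := sub_ne_zero.mpr (by exact_mod_cast hn.2.1)
    have h3 : (n : ℝ) - L ≠ 0 := sub_ne_zero.mpr (by exact_mod_cast hn.2.2)
    have := three_pole_partialFraction n (n - K) (n - L) (-K) (-L) h1 h2 h3 (neg_ne_zero.mpr hK')
      (neg_ne_zero.mpr hL') (by simpa using hKL') (sub_eq_add_neg _ _) (sub_eq_add_neg _ _) c a b hb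
    rw [mul_assoc] at this
    rw [this]
    simp only [Int.cast_zero, sub_zero, neg_neg, sub_neg_eq_add, neg_add_eq_sub]

theorem mem_one_iff {x : ℝ} : x ∈ (1 : Submodule zetaAlgebra ℝ) ↔ x ∈ zetaAlgebra := by
  rw [Submodule.mem_one]
  exact ⟨fun ⟨y, hy⟩ => hy ▸ y.2, fun h => ⟨⟨x, h⟩, rfl⟩⟩

/-- The double sum `∑_{n ∈ ℤ, k ≥ 1} n⁻ᶜ (n - k)⁻ᵃ` is a polynomial in zeta values. -/
theorem tsum_double_mem {a c : ℕ} (ha : 2 ≤ a) (hc : 2 ≤ c) :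
    ∑' p : ℤ × ℕ, ((p.1 : ℝ) ^ c)⁻¹ * (((p.1 : ℝ) - (p.2 + 1)) ^ a)⁻¹ ∈ zetaAlgebra := by
  have hs := summable_double ha hc
  have hs' := hs.prod_symm
  rw [tsum_prod_swap hs]
  have hf (k : ℕ) := tsum_two_pole (K := k + 1) (by omega) (show a ≠ 0 by omega)
    (show c ≠ 0 by omega) (by simpa using hs'.prod_factor k)
  push_cast at hf
  simp only [hf]
  rw [← mem_one_iff]
  set N := seriesIn ℕ (1 : Submodule zetaAlgebra ℝ)
  -- Only one gap, ±K, occurs here. A dummy second gap equal to 1 with exponent 0 makes the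
  -- two-variable closure lemmas applicable.
  have H1 (a : ℕ) (ha : 2 ≤ a) : ∀ α ≥ a, ∀ β ≥ 0, (fun k : ℕ => (fun _ => (1 : ℝ)) k
      * (((fun k : ℕ => (k : ℝ) + 1) k ^ α)⁻¹ * ((fun _ => (1 : ℝ)) k ^ β)⁻¹)) ∈ N := by
    intro α hα β _
    refine mem_seriesIn_of_hasSum ?_ (mem_one_iff.mpr (zetaValue_mem (ha.trans hα)))
    simpa using hasSum_zetaValue (ha.trans hα)
  have H2 (a : ℕ) (ha : 2 ≤ a) : ∀ α ≥ a, ∀ β ≥ 0, (fun k : ℕ => (fun _ => (1 : ℝ)) k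
      * (((fun k : ℕ => -((k : ℝ) + 1)) k ^ α)⁻¹ * ((fun _ => (1 : ℝ)) k ^ β)⁻¹)) ∈ N := by
    intro α hα β hβ
    convert mul_mem_submodule N (neg_one_pow_mem α) (H1 a ha α hα β hβ) using 2 with k
    simp only [inv_neg_pow, one_pow, inv_one, mul_one, one_mul]
  have A1 := sum_coeff_mul_symmZeta_mem N (H2 a ha) c
  have A2 := sum_coeff_mul_symmZeta_mem N (H1 c hc) a
  have B1 := polarSum_neg_left_mem N (H1 c hc) a
  have B2 := polarSum_neg_left_mem N (H2 a ha) c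
  simp only [invPowSeries_zero, mul_one, one_mul, neg_neg] at A1 A2 B1 B2
  exact (N.sub_mem (N.add_mem A1 A2) (N.add_mem B1 B2)).2

/-- The triple sum `∑_{n ∈ ℤ, k, l ≥ 1} n⁻ᶜ (n - k)⁻ᵃ (n - l)⁻ᵇ` reduces to linear sums. -/
theorem tsum_triple_mem {a b c : ℕ} (ha : 2 ≤ a) (hb : 2 ≤ b) (hc : 2 ≤ c) :
    ∑' p : ℤ × (ℕ × ℕ), ((p.1 : ℝ) ^ c)⁻¹ *
      ((((p.1 : ℝ) - (p.2.1 + 1)) ^ a)⁻¹ * (((p.1 : ℝ) - (p.2.2 + 1)) ^ b)⁻¹)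
      ∈ linearReducible := by
  have hs := summable_triple ha hb hc
  have hs' := hs.prod_symm
  rw [tsum_prod_swap hs]
  set N := seriesIn (ℕ × ℕ) linearReducible
  set I : ℕ × ℕ → ℝ := fun p => ∑' n : ℤ, ((n : ℝ) ^ c)⁻¹ *
      ((((n : ℝ) - (p.1 + 1)) ^ a)⁻¹ * (((n : ℝ) - (p.2 + 1)) ^ b)⁻¹) with hI
  -- For k = l the two poles merge into one of order a + b, and the double sum applies.
  have hdiag : (fun p : ℕ × ℕ => if p.1 = p.2 then I (p.1, p.1) else 0) ∈ N := by
    have h1 := summable_double (show 2 ≤ a + b by omega) hc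
    have h2 := h1.prod_symm
    have h3 := (hasSum_congr (f := fun k => I (k, k)) fun k => by
      simp only [hI, Prod.swap_prod_mk, pow_add, mul_inv]).mpr h2.prod.hasSum
    refine mem_seriesIn_of_hasSum (hasSum_diagonal h3) ?_
    simp only [Prod.swap_prod_mk]
    rw [← tsum_prod_swap h1]
    exact mem_linearReducible_of_mem (tsum_double_mem (by omega) hc)
  -- `K1`, `K2`, `K3` treat the pairs of gaps seen from the poles n = 0, K, L: (-K, -L), (K, K - L)
  -- and (L, L - K).
  have K1 (a b : ℕ) (ha : 2 ≤ a) (hb : 2 ≤ b) : ∀ α ≥ a, ∀ β ≥ b, (fun p : ℕ × ℕ => offDiag p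
      * (((fun p : ℕ × ℕ => -((p.1 : ℝ) + 1)) p ^ α)⁻¹
        * ((fun p : ℕ × ℕ => -((p.2 : ℝ) + 1)) p ^ β)⁻¹)) ∈ N := by
    intro α hα β hβ
    convert mul_mem_submodule N (mul_mem (neg_one_pow_mem α) (neg_one_pow_mem β))
      (offDiag_product_mem (ha.trans hα) (hb.trans hβ)) using 2 with p
    simp only [inv_neg_pow]
    ring
  have K2 (a b : ℕ) (ha : 2 ≤ a) (hb : 2 ≤ b) : ∀ α ≥ a, ∀ β ≥ b, (fun p : ℕ × ℕ => offDiag p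
      * (((fun p : ℕ × ℕ => (p.1 : ℝ) + 1) p ^ α)⁻¹
        * ((fun p : ℕ × ℕ => (p.1 : ℝ) + 1 - (p.2 + 1)) p ^ β)⁻¹)) ∈ N := by
    intro α hα β hβ
    simpa only [add_sub_add_right_eq_sub] using
      offDiag_difference_mem (ha.trans hα) (hb.trans hβ)
  have K3 (a b : ℕ) (ha : 2 ≤ a) (hb : 2 ≤ b) : ∀ α ≥ a, ∀ β ≥ b, (fun p : ℕ × ℕ => offDiag p
      * (((fun p : ℕ × ℕ => (p.2 : ℝ) + 1) p ^ α)⁻¹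
        * ((fun p : ℕ × ℕ => (p.2 : ℝ) + 1 - (p.1 + 1)) p ^ β)⁻¹)) ∈ N := by
    intro α hα β hβ
    simpa only [add_sub_add_right_eq_sub] using
      offDiag_difference_swap_mem (ha.trans hα) (hb.trans hβ)
  have hoff : (fun p : ℕ × ℕ => offDiag p * I p) ∈ N := by
    -- The `A` terms are the symmetric sums of the three principal parts; the `B` terms are the
    -- corrections at n = 0 (`B1`, `B2`), K (`B3`, `B4`) and L (`B5`, `B6`).
    have A1 := sum_coeff_mul_symmZeta_mem N (K1 a b ha hb) c
    have A2 := sum_coeff_mul_symmZeta_mem N (K2 c b hc hb) a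
    have A3 := sum_coeff_mul_symmZeta_mem N (K3 c a hc ha) b
    have B1 := polarSum_neg_left_mem N (K2 c b hc hb) a
    have B2 := polarSum_neg_left_mem N (K3 c a hc ha) b
    have B3 := polarSum_neg_left_mem N (K1 a b ha hb) c
    have B4 := polarSum_neg_right_mem N (K3 c a hc ha) b
    have B5 := polarSum_neg_right_mem N (K1 a b ha hb) c
    have B6 := polarSum_neg_right_mem N (K2 c b hc hb) a
    convert N.sub_mem (N.add_mem (N.add_mem A1 A2) A3) (N.add_mem (N.add_mem B1 B2)
      (N.add_mem (N.add_mem B3 B4) (N.add_mem B5 B6))) using 1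
    ext p
    by_cases hp : p.1 = p.2
    · simp [offDiag, hp]
    · have := tsum_three_pole (K := p.1 + 1) (L := p.2 + 1) (by omega) (by omega) (by omega)
        (show a ≠ 0 by omega) (show b ≠ 0 by omega) (show c ≠ 0 by omega)
        (by simpa using hs'.prod_factor p)
      push_cast at this
      simp only [hI, this, Pi.sub_apply, Pi.add_apply, neg_neg, mul_add, mul_sub]
  have hsum := (N.add_mem hoff hdiag).2
  convert hsum using 2
  ext p
  by_cases hp : p.1 = p.2
  · obtain ⟨k, l⟩ := p
    obtain rfl : k = l := hp
    simp [offDiag, hI]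
  · simp [offDiag, hI, hp]

/-! ### Telescoping identities. -/

theorem tendsto_genHarmonic {r : ℕ} (hr : 2 ≤ r) :
    Tendsto (genHarmonic r) atTop (𝓝 (zetaValue r)) := by
  refine (hasSum_zetaValue hr).tendsto_sum_nat.congr fun n => ?_
  induction n with
  | zero => simp [genHarmonic_zero]
  | succ n ih => rw [genHarmonic_succ, Finset.sum_range_succ, ih]

/-- Telescoping of the powers of the generalized harmonic numbers. -/
theorem eq_zetaValue_pow {r m : ℕ} (hr : 2 ≤ r) (hm : m ≠ 0) {f : ℕ → ℝ} {s : ℝ}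
    (hf : HasSum f s) (h : ∀ n, f n = genHarmonic r (n + 1) ^ m - genHarmonic r n ^ m) :
    s = zetaValue r ^ m := by
  refine tendsto_nhds_unique hf.tendsto_sum_nat (((tendsto_genHarmonic hr).pow m).congr fun N => ?_)
  simp only [h]
  rw [Finset.sum_range_sub (fun n => genHarmonic r n ^ m), genHarmonic_zero, zero_pow hm, sub_zero]

theorem hasSum_eulerSum_sq {r q : ℕ} (hr : 1 ≤ r) (hq : 2 ≤ q) :
    HasSum (fun n : ℕ => genHarmonic r (n + 1) ^ 2 * (((n : ℝ) + 1) ^ q)⁻¹)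
      (eulerSum {r, r} q) := by
  simpa [sq] using hasSum_eulerSum {r, r} (by simpa using hr) q hq

theorem hasSum_eulerSum_cube {r q : ℕ} (hr : 1 ≤ r) (hq : 2 ≤ q) :
    HasSum (fun n : ℕ => genHarmonic r (n + 1) ^ 3 * (((n : ℝ) + 1) ^ q)⁻¹)
      (eulerSum {r, r, r} q) := by
  simpa [pow_succ', mul_assoc] using hasSum_eulerSum {r, r, r} (by simpa using hr) q hq

theorem eulerSum_self {r : ℕ} (hr : 2 ≤ r) :
    2 * eulerSum {r} r - zetaValue (2 * r) = zetaValue r ^ 2 := by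
  refine eq_zetaValue_pow hr two_ne_zero (((hasSum_linear_eulerSum (by omega) hr).mul_left 2).sub
    (hasSum_zetaValue (show 2 ≤ 2 * r by omega))) fun n => ?_
  rw [genHarmonic_succ, mul_comm 2 r, pow_mul]
  ring

theorem eulerSum_sq_self {r : ℕ} (hr : 2 ≤ r) :
    3 * eulerSum {r, r} r - 3 * eulerSum {r} (2 * r) + zetaValue (3 * r) = zetaValue r ^ 3 := by
  refine eq_zetaValue_pow hr three_ne_zero ((((hasSum_eulerSum_sq (by omega) hr).mul_left 3).sub
    ((hasSum_linear_eulerSum (by omega) (show 2 ≤ 2 * r by omega)).mul_left 3)).add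
    (hasSum_zetaValue (show 2 ≤ 3 * r by omega))) fun n => ?_
  rw [genHarmonic_succ, mul_comm 2 r, mul_comm 3 r, pow_mul, pow_mul]
  ring

theorem eulerSum_cube_self {r : ℕ} (hr : 2 ≤ r) :
    4 * eulerSum {r, r, r} r - 6 * eulerSum {r, r} (2 * r) + 4 * eulerSum {r} (3 * r)
      - zetaValue (4 * r) = zetaValue r ^ 4 := by
  refine eq_zetaValue_pow hr four_ne_zero (((((hasSum_eulerSum_cube (by omega) hr).mul_left 4).sub
    ((hasSum_eulerSum_sq (by omega) (show 2 ≤ 2 * r by omega)).mul_left 6)).add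
    ((hasSum_linear_eulerSum (by omega) (show 2 ≤ 3 * r by omega)).mul_left 4)).sub
    (hasSum_zetaValue (show 2 ≤ 4 * r by omega))) fun n => ?_
  rw [genHarmonic_succ, mul_comm 2 r, mul_comm 3 r, mul_comm 4 r, pow_mul, pow_mul, pow_mul]
  ring

/-! ### Comparison of the two orders of summation. -/

/-- The triple sum `∑_{n ∈ ℤ, k, l ≥ 1} n⁻²ʳ (n - k)⁻ʳ (n - l)⁻ʳ`, summed over `k` and `l` first. -/
theorem tsum_triple_eq {r : ℕ} (hr : 2 ≤ r) :
    ∑' p : ℤ × (ℕ × ℕ), ((p.1 : ℝ) ^ (2 * r))⁻¹ *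
      ((((p.1 : ℝ) - (p.2.1 + 1)) ^ r)⁻¹ * (((p.1 : ℝ) - (p.2.2 + 1)) ^ r)⁻¹)
      = (eulerSum {r, r} (2 * r) - 2 * eulerSum {r} (3 * r) + zetaValue (4 * r)
          + 2 * ((-1) ^ r * zetaValue r) * eulerSum {r} (2 * r)
          - 2 * ((-1) ^ r * zetaValue r) * zetaValue (3 * r)
          + zetaValue r ^ 2 * zetaValue (2 * r))
        + (zetaValue r ^ 2 * zetaValue (2 * r) - 2 * zetaValue r * eulerSum {r} (2 * r)
          + eulerSum {r, r} (2 * r)) := by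
  have hs := summable_triple hr hr (show 2 ≤ 2 * r by omega)
  have h1 := hasSum_eulerSum_sq (show 1 ≤ r by omega) (show 2 ≤ 2 * r by omega)
  have h2 := hasSum_linear_eulerSum (show 1 ≤ r by omega) (show 2 ≤ 3 * r by omega)
  have h3 := hasSum_zetaValue (show 2 ≤ 4 * r by omega)
  have h4 := hasSum_linear_eulerSum (show 1 ≤ r by omega) (show 2 ≤ 2 * r by omega)
  have h5 := hasSum_zetaValue (show 2 ≤ 3 * r by omega)
  have h6 := hasSum_zetaValue (show 2 ≤ 2 * r by omega)
  have hsign : ((-1 : ℝ) ^ r) ^ 2 = 1 := by rw [← pow_mul, mul_comm, pow_mul]; simp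
  have hrow {x s : ℝ} (h : HasSum (fun k : ℕ => ((x - (k + 1)) ^ r)⁻¹) s) :
      ∑' q : ℕ × ℕ, (x ^ (2 * r))⁻¹ * (((x - (q.1 + 1)) ^ r)⁻¹ * ((x - (q.2 + 1)) ^ r)⁻¹)
        = (x ^ (2 * r))⁻¹ * s ^ 2 := by
    rw [tsum_mul_left, sq]
    congr 1
    exact (h.mul h (summable_mul_of_summable_norm h.summable.norm h.summable.norm)).tsum_eq
  rw [hs.tsum_prod]
  refine (hasSum_int_of_zero (by simp [show r ≠ 0 by omega]) ?_ ?_).tsum_eq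
  · refine (hasSum_congr fun n => ?_).mpr (((((h1.sub (h2.mul_left 2)).add h3).add
      (h4.mul_left (2 * ((-1) ^ r * zetaValue r)))).sub
      (h5.mul_left (2 * ((-1) ^ r * zetaValue r)))).add (h6.mul_left (zetaValue r ^ 2)))
    push_cast
    rw [hrow (hasSum_row_pos hr n), genHarmonic_succ, mul_comm 2 r, mul_comm 3 r, mul_comm 4 r,
      pow_mul, pow_mul, pow_mul]
    linear_combination (((((n : ℝ) + 1) ^ r) ^ 2)⁻¹ * zetaValue r ^ 2) * hsign
  · refine (hasSum_congr fun n => ?_).mpr (((h6.mul_left (zetaValue r ^ 2)).sub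
      (h4.mul_left (2 * zetaValue r))).add h1)
    have h := hasSum_row_neg hr (n + 1)
    push_cast at h ⊢
    rw [hrow h, inv_neg_pow, pow_mul (-1 : ℝ) 2 r, neg_one_sq, one_pow]
    linear_combination ((((n : ℝ) + 1) ^ (2 * r))⁻¹
      * (zetaValue r - genHarmonic r (n + 1)) ^ 2) * hsign

/-- The rows enter squared and 2r is even, so n > 0 and n < 0 both contribute +S_{r^2,2r}, whatever
the parity of r. It can therefore be solved for. -/
theorem eulerSum_sq_double_mem {r : ℕ} (hr : 2 ≤ r) :
    eulerSum {r, r} (2 * r) ∈ linearReducible := by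
  have hT := tsum_triple_mem hr hr (show 2 ≤ 2 * r by omega)
  rw [tsum_triple_eq hr] at hT
  have hz := zetaValue_mem hr
  have hsz := mul_mem (neg_one_pow_mem r) hz
  have hhalf := ratCast_mem (1 / 2)
  have hS2 : eulerSum {r} (2 * r) ∈ linearReducible := eulerSum_mem (by omega) (by omega)
  have hS3 : eulerSum {r} (3 * r) ∈ linearReducible := eulerSum_mem (by omega) (by omega)
  have h3 := mem_linearReducible_of_mem (mul_mem hsz (zetaValue_mem (show 2 ≤ 3 * r by omega)))
  have h4 := mem_linearReducible_of_mem (zetaValue_mem (show 2 ≤ 4 * r by omega))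
  have h2 := mem_linearReducible_of_mem
    (mul_mem (pow_mem hz 2) (zetaValue_mem (show 2 ≤ 2 * r by omega)))
  have key := add_mem (add_mem (sub_mem (add_mem (sub_mem (sub_mem
    (mul_mem_linearReducible hhalf hT) (mul_mem_linearReducible hhalf h4)) h2) hS3)
    (mul_mem_linearReducible hsz hS2)) h3) (mul_mem_linearReducible hz hS2)
  convert key using 1
  push_cast
  ring

/-- The weight 3r is odd, so the linear sums from n > 0 and n < 0 add up instead of cancelling. -/
theorem eulerSum_linear_mem_of_odd {r : ℕ} (hr : 2 ≤ r) (hodd : Odd r) :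
    eulerSum {r} (2 * r) ∈ zetaAlgebra := by
  have hT := tsum_double_mem hr (show 2 ≤ 2 * r by omega)
  rw [(hasSum_double hr (show 2 ≤ 2 * r by omega)).tsum_eq, hodd.neg_one_pow,
    show r + 2 * r = 3 * r by ring,
    (show Odd (3 * r) from Nat.odd_mul.mpr ⟨by decide, hodd⟩).neg_one_pow]
    at hT
  have h2 := zetaValue_mem (show 2 ≤ 2 * r by omega)
  have h3 := zetaValue_mem (show 2 ≤ 3 * r by omega)
  have key := add_mem (mul_mem (ratCast_mem (1 / 2)) (add_mem hT h3))
    (mul_mem (zetaValue_mem hr) h2)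
  convert key using 1
  push_cast
  ring

end EulerSums

theorem mainTheorem11 (r : ℕ) (hr : 2 ≤ r) :
    EulerSums.eulerSum {r, r} r =
        1 / 3 * EulerSums.zetaValue r ^ 3 - 1 / 3 * EulerSums.zetaValue (3 * r)
          + EulerSums.eulerSum {r} (2 * r) ∧
    EulerSums.eulerSum {r, r, r} r =
        1 / 4 * EulerSums.zetaValue r ^ 4 + 3 / 4 * EulerSums.zetaValue (2 * r) ^ 2
          + EulerSums.zetaValue (4 * r) - EulerSums.eulerSum {r} (3 * r)
          + 3 / 2 * EulerSums.eulerSum {r, r} (2 * r)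
          - 3 / 2 * EulerSums.eulerSum {2 * r} (2 * r) ∧
    EulerSums.eulerSum {r, r} r ∈ EulerSums.linearReducible ∧
    EulerSums.eulerSum {r, r, r} r ∈ EulerSums.linearReducible ∧
    (Odd r → EulerSums.eulerSum {r, r} r ∈ EulerSums.zetaAlgebra) := by
  open EulerSums in
  have e1 := eulerSum_sq_self hr
  have e2 := eulerSum_cube_self hr
  -- Turns 3/4 ζ(2r)^2 - 3/2 S_{2r,2r} into -3/4 ζ(4r), which reconciles the stated formula with the
  -- telescoped one.
  have e3 := eulerSum_self (show 2 ≤ 2 * r by omega)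
  rw [show 2 * (2 * r) = 4 * r by ring] at e3
  have hz := zetaValue_mem hr
  have hP : (1 / 3 : ℚ) * (zetaValue r ^ 3 - zetaValue (3 * r)) ∈ zetaAlgebra :=
    mul_mem (ratCast_mem _) (sub_mem (pow_mem hz 3) (zetaValue_mem (by omega)))
  have hQ : (1 / 4 : ℚ) * (zetaValue r ^ 4 + zetaValue (4 * r)) ∈ zetaAlgebra :=
    mul_mem (ratCast_mem _) (add_mem (pow_mem hz 4) (zetaValue_mem (by omega)))
  have f1 : eulerSum {r, r} r
      = (1 / 3 : ℚ) * (zetaValue r ^ 3 - zetaValue (3 * r)) + eulerSum {r} (2 * r) := by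
    push_cast; linarith
  have f2 : eulerSum {r, r, r} r = (1 / 4 : ℚ) * (zetaValue r ^ 4 + zetaValue (4 * r))
      - eulerSum {r} (3 * r) + (3 / 2 : ℚ) * eulerSum {r, r} (2 * r) := by
    push_cast; linarith
  refine ⟨by linarith, by linarith, ?_, ?_, fun hodd => ?_⟩
  · rw [f1]
    exact add_mem (mem_linearReducible_of_mem hP) (eulerSum_mem (by omega) (by omega))
  · rw [f2]
    exact add_mem (sub_mem (mem_linearReducible_of_mem hQ) (eulerSum_mem (by omega) (by omega)))
      (mul_mem_linearReducible (ratCast_mem _) (eulerSum_sq_double_mem hr))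
  · rw [f1]
    exact add_mem hP (eulerSum_linear_mem_of_odd hr hodd)
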